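/- Let $p$ be a prime, let $m\geq 1$ and $r\geq 1$ be integers, and for $\beta\in\mathbb{Z}/p^m\mathbb{Z}$ let $$N_\beta=\left|\{X\in \mathrm{GL}_r(\mathbb{Z}/p^m\mathbb{Z}) : \operatorname{tr} X=\beta\}\right|$$ be the number of invertible $r\times r$ matrices over $\mathbb{Z}/p^m\mathbb{Z}$ with trace $\beta$. Write $\gcd(\beta,p^m)=p^t$ with $0\leq t\leq m$ (so $t=m$ for $\beta=0$). Then $$N_\beta=\begin{cases}p^{m(r^2-1)}\left(\prod_{i=1}^r(1-p^{-i})-(-1)^r p^{-r(r+1)/2}\right), & \text{if } t=0,\\[4pt] p^{m(r^2-1)}\left(\prod_{i=1}^r(1-p^{-i})+(-1)^r p^{-r(r+1)/2}(p-1)\right), & \text{if } 1\leq t\leq m.\end{cases}$$ In particular, $N_\beta$ depends only on whether $p\mid\beta$. -/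

import Mathlib

open scoped MatrixGroups

/-- `traceCount r n β` is `N_β`: the number of matrices `X ∈ GL_r(ℤ/nℤ)` with `tr X = β`. -/
noncomputable def traceCount (r n : ℕ) (β : ZMod n) : ℕ :=
  Nat.card {X : GL (Fin r) (ZMod n) // (X : Matrix (Fin r) (Fin r) (ZMod n)).trace = β}

/-! Invertibility is detected modulo `p`, so `N_β` is the count over `𝔽_p` at trace `β mod p` times
a fibre size independent of `β` (`card_isUnit_det_trace_of_surjective`). Over a field with `q`
elements, let `S_n` be the sum of `φ (tr X)` over invertible `X` of size `n`, where `∑ φ = 0`.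
Splitting by the last row gives `S_{n+1} = -q^n S_n` (`invertibleTraceSum_sum_unit`), hence `S_r =
(-1)^r q^(r.choose 2) φ 0`. A centred indicator for `φ` then turns `|GL_r|` into the count at each
trace. -/

theorem AddMonoidHom.card_ker_mul_card_range {G H : Type*} [AddGroup G] [AddGroup H]
    (g : G →+ H) : Nat.card g.ker * Nat.card g.range = Nat.card G := by
  rw [← AddSubgroup.index_ker, AddSubgroup.card_mul_index]

/-! ### Bordered matrices and trace sums over a finite field. -/

namespace Matrix

/-- A square matrix bordered by one column, one row and a corner entry. -/
def borderEquiv (ι R : Type*) :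
    Matrix Unit ι R × Matrix ι ι R × Matrix ι Unit R × R ≃ Matrix (ι ⊕ Unit) (ι ⊕ Unit) R where
  toFun x := fromBlocks x.2.1 x.2.2.1 x.1 (of fun _ _ => x.2.2.2)
  invFun X := (X.toBlocks₂₁, X.toBlocks₁₁, X.toBlocks₁₂, X (.inr ()) (.inr ()))
  left_inv x := by simp
  right_inv X := by
    conv_rhs => rw [← fromBlocks_toBlocks X]
    rfl

theorem borderEquiv_trace {ι R : Type*} [CommRing R] [Fintype ι] (A : Matrix ι ι R)
    (B : Matrix ι Unit R) (C : Matrix Unit ι R) (d : R) :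
    (borderEquiv ι R (C, A, B, d)).trace = A.trace + d := by
  simp [borderEquiv, Matrix.trace]

/-- Right multiplication by a unipotent block matrix. The trace moves by `t` while the determinant
stays fixed. -/
theorem borderEquiv_det_shift {ι R : Type*} [CommRing R] [Fintype ι] [DecidableEq ι]
    (A : Matrix ι ι R) (B : Matrix ι Unit R) (C : Matrix Unit ι R) (d t : R) (u : Matrix ι Unit R)
    (hu : C * u = 1) :
    (borderEquiv ι R (C, A, B + A * (t • u), d + t)).det = (borderEquiv ι R (C, A, B, d)).det := by
  have h : borderEquiv ι R (C, A, B + A * (t • u), d + t) =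
      borderEquiv ι R (C, A, B, d) * fromBlocks 1 (t • u) 0 1 := by
    simp only [borderEquiv, Equiv.coe_fn_mk, fromBlocks_multiply]
    congr 1
    · simp
    · simp [add_comm]
    · simp
    · rw [Matrix.mul_smul, hu]
      ext i j
      simp [add_comm]
  rw [h, det_mul, det_fromBlocks_zero₂₁]
  simp

section FieldCount

variable {K : Type*} [Field K] [Fintype K]

open scoped Classical in
/-- The sum of `φ (tr X)` over the invertible matrices `X`. -/
noncomputable def invertibleTraceSum (ι : Type*) [Fintype ι] [DecidableEq ι] (φ : K → ℝ) : ℝ :=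
  ∑ X : Matrix ι ι K, if IsUnit X.det then φ X.trace else 0

theorem invertibleTraceSum_congr {ι κ : Type*} [Fintype ι] [DecidableEq ι] [Fintype κ]
    [DecidableEq κ] (e : ι ≃ κ) (φ : K → ℝ) :
    invertibleTraceSum ι φ = invertibleTraceSum κ φ := by
  classical
  unfold invertibleTraceSum
  refine Fintype.sum_equiv (Matrix.reindex e e) _ _ fun X => ?_
  have h : (Matrix.reindex e e X).trace = X.trace := by
    simp only [Matrix.trace, Matrix.diag, Matrix.reindex_apply, Matrix.submatrix_apply]
    exact Equiv.sum_comp e.symm fun i => X i i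
  rw [Matrix.det_reindex_self, h]

theorem sum_border_of_ne_zero {ι : Type*} [Fintype ι] [DecidableEq ι] (φ : K → ℝ)
    (hφ : ∑ x, φ x = 0) (C : Matrix Unit ι K) (hC : C ≠ 0) (A : Matrix ι ι K)
    [DecidablePred fun X : Matrix (ι ⊕ Unit) (ι ⊕ Unit) K => IsUnit X.det] :
    ∑ y : Matrix ι Unit K × K, (if IsUnit (borderEquiv ι K (C, A, y)).det then
      φ (borderEquiv ι K (C, A, y)).trace else 0) = 0 := by
  obtain ⟨i, hi⟩ : ∃ i, C () i ≠ 0 := by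
    by_contra! h
    exact hC (by ext a j; exact h j)
  obtain ⟨u, hu⟩ : ∃ u : Matrix ι Unit K, C * u = 1 := by
    refine ⟨Matrix.single i () (C () i)⁻¹, ?_⟩
    ext a b
    simp [hi]
  set g : Matrix ι Unit K × K → ℝ := fun y => if IsUnit (borderEquiv ι K (C, A, y)).det then
      φ (borderEquiv ι K (C, A, y)).trace else 0 with hg
  have shift (t : K) : ∑ y, g y = ∑ y : Matrix ι Unit K × K,
      if IsUnit (borderEquiv ι K (C, A, y)).det then φ (A.trace + y.2 + t) else 0 := by
    rw [← Equiv.sum_comp (Equiv.addRight ((A * (t • u), t) : Matrix ι Unit K × K)) g]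
    refine Finset.sum_congr rfl fun y _ => ?_
    obtain ⟨B, d⟩ := y
    simp only [hg, Equiv.coe_addRight, Prod.mk_add_mk, borderEquiv_det_shift A B C d t u hu,
      borderEquiv_trace, add_assoc]
  -- The sum does not depend on the shift `t`; averaging over `t` runs `φ` through all of `K`.
  have key : ∑ _t : K, ∑ y, g y = 0 := by
    rw [Finset.sum_congr rfl fun t _ => shift t, Finset.sum_comm]
    refine Finset.sum_eq_zero fun y _ => ?_
    split_ifs
    · rw [← hφ]
      exact Equiv.sum_comp (Equiv.addLeft (A.trace + y.2)) φ
    · simp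
  simpa using key

/-- Only the zero bottom row `C` contributes. Then the determinant is `det A * d`, the column `B` is
free, and summing over `d ≠ 0` gives `-φ (tr A)`. -/
theorem invertibleTraceSum_sum_unit {ι : Type*} [Fintype ι] [DecidableEq ι] (φ : K → ℝ)
    (hφ : ∑ x, φ x = 0) :
    invertibleTraceSum (ι ⊕ Unit) φ =
      -(Fintype.card K : ℝ) ^ Fintype.card ι * invertibleTraceSum ι φ := by
  classical
  have inner (s : K) : ∑ d : K, (if d ≠ 0 then φ (s + d) else 0) = -φ s := by
    have h := Equiv.sum_comp (Equiv.addLeft s) φ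
    rw [hφ, ← Finset.add_sum_erase _ _ (Finset.mem_univ 0)] at h
    rw [← Finset.sum_filter, Finset.filter_ne' Finset.univ (0 : K)]
    simp only [Equiv.coe_addLeft, add_zero] at h
    linarith
  unfold invertibleTraceSum
  rw [← Equiv.sum_comp (borderEquiv ι K), Fintype.sum_prod_type, Finset.sum_eq_single 0]
  · rw [Fintype.sum_prod_type, Finset.mul_sum]
    refine Finset.sum_congr rfl fun A _ => ?_
    have hdet (B : Matrix ι Unit K) (d : K) :
        IsUnit (borderEquiv ι K (0, A, B, d)).det ↔ IsUnit A.det ∧ d ≠ 0 := by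
      simp [borderEquiv, det_fromBlocks_zero₂₁]
    rw [Fintype.sum_prod_type]
    simp only [hdet, borderEquiv_trace]
    by_cases hA : IsUnit A.det
    · have hcard : Fintype.card (Matrix ι Unit K) = Fintype.card K ^ Fintype.card ι := by
        rw [← Nat.card_eq_fintype_card]
        simp [Matrix]
      simp only [hA, true_and, if_true, inner, Finset.sum_const, Finset.card_univ, hcard]
      simp
    · simp only [hA, false_and, if_false, Finset.sum_const_zero, mul_zero]
  · intro C _ hC
    rw [Fintype.sum_prod_type]
    exact Finset.sum_eq_zero fun A _ => sum_border_of_ne_zero φ hφ C hC A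
  · simp

theorem invertibleTraceSum_fin (n : ℕ) (φ : K → ℝ) (hφ : ∑ x, φ x = 0) :
    invertibleTraceSum (Fin n) φ = (-1) ^ n * (Fintype.card K : ℝ) ^ (n.choose 2) * φ 0 := by
  induction n with
  | zero =>
    have hcard : Fintype.card (Matrix (Fin 0) (Fin 0) K) = 1 := by
      rw [← Nat.card_eq_fintype_card]
      simp [Matrix]
    simp [invertibleTraceSum, hcard]
  | succ n ih =>
    rw [invertibleTraceSum_congr ((finSumFinEquiv (m := n) (n := 1)).symm.trans
      (Equiv.sumCongr (Equiv.refl _) (Equiv.equivPUnit _))), invertibleTraceSum_sum_unit φ hφ, ih,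
      Fintype.card_fin, Nat.choose_succ_succ' n 1, Nat.choose_one_right, pow_add, pow_succ]
    ring

end FieldCount

/-! ### Counts over a finite field. -/

/-- Invertible matrices of trace `β`, counted as matrices with invertible determinant. -/
theorem card_GL_trace_eq {R : Type*} [CommRing R] (r : ℕ) (β : R) :
    Nat.card {X : GL (Fin r) R // (X : Matrix (Fin r) (Fin r) R).trace = β} =
      Nat.card {X : Matrix (Fin r) (Fin r) R // IsUnit X.det ∧ X.trace = β} := by
  refine Nat.card_congr
    { toFun := fun X => ⟨X.1, (Matrix.isUnit_iff_isUnit_det _).1 X.1.isUnit, X.2⟩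
      invFun := fun X => ⟨((Matrix.isUnit_iff_isUnit_det _).2 X.2.1).unit, X.2.2⟩
      left_inv := fun X => by ext; simp
      right_inv := fun X => by ext; simp }

theorem card_GL_eq_card_isUnit_det {R : Type*} [CommRing R] (r : ℕ) :
    Nat.card (GL (Fin r) R) = Nat.card {X : Matrix (Fin r) (Fin r) R // IsUnit X.det} := by
  refine Nat.card_congr
    { toFun := fun X => ⟨X, (Matrix.isUnit_iff_isUnit_det _).1 X.isUnit⟩
      invFun := fun X => ((Matrix.isUnit_iff_isUnit_det _).2 X.2).unit
      left_inv := fun X => by ext; simp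
      right_inv := fun X => by ext; simp }

theorem card_mul_card_isUnit_det_trace {K : Type*} [Field K] [Fintype K] [DecidableEq K] (r : ℕ)
    (β : K) :
    (Fintype.card K : ℝ) *
        Nat.card {X : Matrix (Fin r) (Fin r) K // IsUnit X.det ∧ X.trace = β} =
      Nat.card (GL (Fin r) K) + (-1) ^ r * (Fintype.card K : ℝ) ^ (r.choose 2) *
        ((if β = 0 then (Fintype.card K : ℝ) else 0) - 1) := by
  classical
  -- `q` times the indicator of `β`, minus `1`, has total sum zero.
  have h := invertibleTraceSum_fin (K := K) r
    (fun x => (if β = x then (Fintype.card K : ℝ) else 0) - 1) (by simp)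
  rw [← h, card_GL_eq_card_isUnit_det, Nat.card_eq_fintype_card, Nat.card_eq_fintype_card,
    Fintype.card_subtype, Fintype.card_subtype, Finset.card_filter, Finset.card_filter,
    invertibleTraceSum]
  push_cast
  rw [Finset.mul_sum, ← Finset.sum_add_distrib]
  refine Finset.sum_congr rfl fun X _ => ?_
  by_cases h1 : IsUnit X.det
  · by_cases h2 : X.trace = β
    · simp only [h1, h2, and_self, if_true]
      ring
    · simp only [h1, h2, Ne.symm h2, and_false, if_true, if_false]
      ring
  · simp only [h1, false_and, if_false]
    ring

theorem card_GL_field_real {K : Type*} [Field K] [Fintype K] (r : ℕ) :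
    (Nat.card (GL (Fin r) K) : ℝ) = (Fintype.card K : ℝ) ^ (r ^ 2) *
      ∏ i ∈ Finset.Icc 1 r, (1 - (Fintype.card K : ℝ) ^ (-(i : ℤ))) := by
  have hq : (Fintype.card K : ℝ) ≠ 0 := by simp
  have h1 : ∀ i : Fin r, Fintype.card K ^ (i : ℕ) ≤ Fintype.card K ^ r := fun i =>
    Nat.pow_le_pow_right Fintype.card_pos i.2.le
  rw [card_GL_field]
  push_cast [Nat.cast_sub (h1 _)]
  have h2 : ∀ i : Fin r, (Fintype.card K : ℝ) ^ r - (Fintype.card K : ℝ) ^ (i : ℕ) =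
      (Fintype.card K : ℝ) ^ r * (1 - (Fintype.card K : ℝ) ^ (-((r - i : ℕ) : ℤ))) := by
    intro i
    have h3 : (Fintype.card K : ℝ) ^ r =
        (Fintype.card K : ℝ) ^ (i : ℕ) * (Fintype.card K : ℝ) ^ (r - i : ℕ) := by
      rw [← pow_add, Nat.add_sub_cancel' i.2.le]
    rw [_root_.zpow_neg, _root_.zpow_natCast, mul_sub, mul_one, h3, mul_assoc,
      mul_inv_cancel₀ (pow_ne_zero _ hq), mul_one]
  simp only [h2]
  rw [Finset.prod_mul_distrib, Finset.prod_const, Finset.card_univ, Fintype.card_fin, ← pow_mul,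
    ← pow_two, Fin.prod_univ_eq_prod_range
      (fun i => 1 - (Fintype.card K : ℝ) ^ (-((r - i : ℕ) : ℤ))) r]
  congr 1
  rw [← Finset.prod_range_reflect, ← Finset.Ico_add_one_right_eq_Icc, Finset.prod_Ico_eq_prod_range]
  refine Finset.prod_congr (by simp) fun i hi => ?_
  rw [Finset.mem_range] at hi
  congr 4
  omega

/-! ### Fibres of reduction at fixed trace. -/

section Reduction

theorem card_matrix_fin (r : ℕ) (T : Type*) :
    Nat.card (Matrix (Fin r) (Fin r) T) = Nat.card T ^ (r ^ 2) := by
  simp [Matrix, Nat.card_fun, ← pow_mul, pow_two]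

variable {R S : Type*} [CommRing R] [CommRing S] (f : R →+* S) (r : ℕ)

/-- Reduction of the entries, together with the trace. -/
def mapTraceHom : Matrix (Fin r) (Fin r) R →+ Matrix (Fin r) (Fin r) S × R :=
  (f.mapMatrix : Matrix (Fin r) (Fin r) R →+* _).toAddMonoidHom.prod (traceAddMonoidHom (Fin r) R)

theorem mapTraceHom_apply (X : Matrix (Fin r) (Fin r) R) :
    mapTraceHom f r X = (f.mapMatrix X, X.trace) := rfl

/-- The defect of a pair `(Y, b)` from being in the range of `mapTraceHom`. -/
def traceDefect : Matrix (Fin r) (Fin r) S × R →+ S :=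
  (traceAddMonoidHom (Fin r) S).comp (AddMonoidHom.fst _ _) -
    f.toAddMonoidHom.comp (AddMonoidHom.snd _ _)

theorem traceDefect_apply (Y : Matrix (Fin r) (Fin r) S) (b : R) :
    traceDefect f r (Y, b) = Y.trace - f b := rfl

theorem range_mapTraceHom (hf : Function.Surjective f) (hr : 1 ≤ r) :
    (mapTraceHom f r).range = (traceDefect f r).ker := by
  ext ⟨Y, b⟩
  rw [AddMonoidHom.mem_ker, traceDefect_apply, AddMonoidHom.mem_range, sub_eq_zero]
  constructor
  · rintro ⟨X, hX⟩
    rw [mapTraceHom_apply, Prod.mk.injEq] at hX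
    rw [← hX.1, ← hX.2]
    simp [Matrix.trace]
  · intro h
    choose s hs using hf
    let i : Fin r := ⟨0, hr⟩
    -- Any entrywise lift has its trace corrected in one diagonal entry; the correction lies in `ker
    -- f`.
    refine ⟨Y.map s + Matrix.single i i (b - (Y.map s).trace), ?_⟩
    have h1 : f (Y.map s).trace = Y.trace := by simp [Matrix.trace, hs]
    rw [mapTraceHom_apply, Prod.mk.injEq]
    constructor
    · ext j k
      have h0 : f (b - (Y.map s).trace) = 0 := by rw [map_sub, h1, h, sub_self]
      simp [Matrix.single_apply, hs, apply_ite f, h0]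
    · simp

theorem traceDefect_surjective (hr : 1 ≤ r) : Function.Surjective (traceDefect f r) := fun s =>
  ⟨(Matrix.single ⟨0, hr⟩ ⟨0, hr⟩ s, 0), by simp [traceDefect_apply]⟩

theorem card_ker_mapTraceHom (hf : Function.Surjective f) (hr : 1 ≤ r) :
    Nat.card R ^ (r ^ 2) * Nat.card S =
      Nat.card (mapTraceHom f r).ker * (Nat.card S ^ (r ^ 2) * Nat.card R) := by
  have h1 := (mapTraceHom f r).card_ker_mul_card_range
  have h2 := (traceDefect f r).card_ker_mul_card_range
  rw [AddMonoidHom.range_eq_top.2 (traceDefect_surjective f r hr), AddSubgroup.card_top,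
    Nat.card_prod] at h2
  rw [range_mapTraceHom f r hf hr] at h1
  rw [card_matrix_fin] at h1 h2
  rw [← h1, ← h2]
  ring

/-- Since `f` is local, every lift of an invertible matrix is invertible, so each fibre is a full
coset of the kernel. -/
theorem card_isUnit_det_trace_of_surjective [IsLocalHom f]
    (hf : Function.Surjective f) (hr : 1 ≤ r) (β : R) :
    Nat.card {X : Matrix (Fin r) (Fin r) R // IsUnit X.det ∧ X.trace = β} =
      Nat.card {Y : Matrix (Fin r) (Fin r) S // IsUnit Y.det ∧ Y.trace = f β} *
        Nat.card (mapTraceHom f r).ker := by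
  have hdet (X : Matrix (Fin r) (Fin r) R) : IsUnit (f.mapMatrix X).det ↔ IsUnit X.det := by
    rw [← RingHom.map_det, isUnit_map_iff]
  have htr (X : Matrix (Fin r) (Fin r) R) : (f.mapMatrix X).trace = f X.trace := by
    simp [Matrix.trace]
  let π : {X : Matrix (Fin r) (Fin r) R // IsUnit X.det ∧ X.trace = β} →
      {Y : Matrix (Fin r) (Fin r) S // IsUnit Y.det ∧ Y.trace = f β} := fun X =>
    ⟨f.mapMatrix X.1, (hdet _).2 X.2.1, (htr X.1).trans (congrArg f X.2.2)⟩
  have hfib (Y) : Nonempty ({X // π X = Y} ≃ (mapTraceHom f r).ker) := by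
    have hY : (Y.1, β) ∈ (mapTraceHom f r).range := by
      rw [range_mapTraceHom f r hf hr, AddMonoidHom.mem_ker, traceDefect_apply, Y.2.2, sub_self]
    obtain ⟨X₀, hX₀⟩ := hY
    have e : {X // π X = Y} ≃ {X // mapTraceHom f r X = (Y.1, β)} :=
        { toFun := fun X => ⟨X.1.1, Prod.ext (congrArg Subtype.val X.2) X.1.2.2⟩
          invFun := fun X =>
            have h : f.mapMatrix X.1 = Y.1 ∧ X.1.trace = β := by
              have := X.2
              rwa [mapTraceHom_apply, Prod.mk.injEq] at this
            ⟨⟨X.1, (hdet _).1 (by rw [h.1]; exact Y.2.1), h.2⟩, Subtype.ext h.1⟩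
          left_inv := fun X => rfl
          right_inv := fun X => rfl }
    rw [← hX₀] at e
    exact ⟨e.trans ((mapTraceHom f r).fiberEquivKer X₀)⟩
  rw [← Nat.card_prod]
  exact Nat.card_congr ((Equiv.sigmaFiberEquiv π).symm.trans
    ((Equiv.sigmaCongrRight fun Y => (hfib Y).some).trans (Equiv.sigmaEquivProd _ _)))

end Reduction

end Matrix

theorem ZMod.isLocalHom_castHom_prime {p m : ℕ} (hp : p.Prime) (hm : 1 ≤ m) :
    IsLocalHom (ZMod.castHom (dvd_pow_self p (by omega : m ≠ 0)) (ZMod p)) := by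
  refine ⟨fun a ha => ?_⟩
  have : NeZero (p ^ m) := ⟨pow_ne_zero _ hp.ne_zero⟩
  obtain ⟨k, rfl⟩ := ZMod.natCast_zmod_surjective a
  rw [map_natCast, ZMod.isUnit_iff_coprime] at ha
  rw [ZMod.isUnit_iff_coprime]
  exact ha.pow_right m

/-! ### Assembly for `ℤ/p^m → 𝔽_p`. -/

theorem theorem7 (r p m : ℕ) (hr : 1 ≤ r) (hp : p.Prime) (hm : 1 ≤ m)
    (β : ZMod (p ^ m)) (t : ℕ) (ht : p ^ t = Nat.gcd β.val (p ^ m)) :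
    (traceCount r (p ^ m) β : ℝ) =
      if t = 0 then
        (p : ℝ) ^ ((m : ℤ) * ((r : ℤ) ^ 2 - 1)) *
          ((∏ i ∈ Finset.Icc 1 r, (1 - (p : ℝ) ^ (-(i : ℤ)))) -
            (-1 : ℝ) ^ r * (p : ℝ) ^ (-((r * (r + 1) / 2 : ℕ) : ℤ)))
      else
        (p : ℝ) ^ ((m : ℤ) * ((r : ℤ) ^ 2 - 1)) *
          ((∏ i ∈ Finset.Icc 1 r, (1 - (p : ℝ) ^ (-(i : ℤ)))) +
            (-1 : ℝ) ^ r * (p : ℝ) ^ (-((r * (r + 1) / 2 : ℕ) : ℤ)) * ((p : ℝ) - 1)) := by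
  have : Fact p.Prime := ⟨hp⟩
  have hm0 : m ≠ 0 := by omega
  have hp0 : (p : ℝ) ≠ 0 := Nat.cast_ne_zero.2 hp.ne_zero
  let f := ZMod.castHom (dvd_pow_self p hm0) (ZMod p)
  have : IsLocalHom f := ZMod.isLocalHom_castHom_prime hp hm
  have hf : Function.Surjective f := ZMod.castHom_surjective _
  have hβ : f β = 0 ↔ t ≠ 0 := by
    have h1 : f β = (β.val : ZMod p) := by
      have : NeZero (p ^ m) := ⟨pow_ne_zero _ hp.ne_zero⟩
      conv_lhs => rw [← ZMod.natCast_zmod_val β]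
      exact map_natCast f _
    rw [h1, ZMod.natCast_eq_zero_iff]
    constructor
    · rintro h rfl
      have h2 := Nat.dvd_gcd h (dvd_pow_self p hm0)
      rw [← ht, pow_zero] at h2
      exact hp.one_lt.ne' (Nat.dvd_one.1 h2)
    · intro h
      exact (dvd_pow_self p h).trans (ht ▸ Nat.gcd_dvd_left _ _)
  have hN := Matrix.card_isUnit_det_trace_of_surjective f r hf hr β
  have hk := Matrix.card_ker_mapTraceHom f r hf hr
  have hF := Matrix.card_mul_card_isUnit_det_trace r (f β)
  rw [Matrix.card_GL_field_real] at hF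
  rw [Nat.card_zmod, Nat.card_zmod] at hk
  rw [ZMod.card] at hF
  rw [traceCount, Matrix.card_GL_trace_eq, hN]
  generalize Nat.card (Matrix.mapTraceHom f r).ker = k at hk ⊢
  generalize Nat.card _ = N at hF ⊢
  generalize (∏ i ∈ Finset.Icc 1 r, (1 - (p : ℝ) ^ (-(i : ℤ)))) = P at hF ⊢
  have hk' : ((p : ℝ) ^ m) ^ (r ^ 2) * p = k * (p ^ (r ^ 2) * p ^ m) := by exact_mod_cast hk
  -- Equivalently, `k = p^((m-1)(r^2-1))`.
  have hE : (p : ℝ) ^ ((m : ℤ) * ((r : ℤ) ^ 2 - 1)) * p = k * p ^ (r ^ 2) := by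
    have h1 : (p : ℝ) ^ ((m : ℤ) * ((r : ℤ) ^ 2 - 1)) * p ^ m = (p ^ m) ^ (r ^ 2) := by
      rw [← zpow_natCast (p : ℝ) m, ← zpow_add₀ hp0, ← zpow_natCast _ (r ^ 2), ← zpow_mul]
      congr 1
      push_cast
      ring
    refine mul_right_cancel₀ (pow_ne_zero m hp0) ?_
    rw [mul_right_comm, h1, hk', mul_assoc]
  have hC : (p : ℝ) ^ (r.choose 2) =
      p ^ (r ^ 2) * (p : ℝ) ^ (-((r * (r + 1) / 2 : ℕ) : ℤ)) := by
    have h1 : r.choose 2 + r * (r + 1) / 2 = r ^ 2 := by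
      have h2 := Nat.choose_two_right (r + 1)
      rw [Nat.add_sub_cancel, mul_comm, Nat.choose_succ_succ' r 1, Nat.choose_one_right] at h2
      rw [← h2, Nat.choose_two_right]
      have h3 := Nat.div_mul_cancel (Nat.even_mul_pred_self r).two_dvd
      obtain ⟨s, rfl⟩ : ∃ s, r = s + 1 := ⟨r - 1, by omega⟩
      rw [Nat.add_sub_cancel] at h3 ⊢
      linarith [h3]
    rw [zpow_neg, zpow_natCast, ← h1, pow_add, mul_assoc, mul_inv_cancel₀ (pow_ne_zero _ hp0),
      mul_one]
  rw [hC] at hF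
  rw [Nat.cast_mul]
  refine mul_left_cancel₀ hp0 ?_
  rw [← mul_assoc, hF]
  by_cases h0 : t = 0
  · rw [if_neg (fun h => hβ.1 h h0), if_pos h0]
    linear_combination (-(P - (-1 : ℝ) ^ r * (p : ℝ) ^ (-((r * (r + 1) / 2 : ℕ) : ℤ)))) * hE
  · rw [if_pos (hβ.2 h0), if_neg h0]
    linear_combination (-(P + (-1 : ℝ) ^ r * (p : ℝ) ^ (-((r * (r + 1) / 2 : ℕ) : ℤ)) * (p - 1))) * hE
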